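/- Let $0<p\le r\le 1$ and let $n$ be a natural number. For positive definite complex $n\times n$ matrices $A,B$, powers are defined by functional calculus. Let $L_A(X)=AX$ and $R_B(X)=XB$ denote left and right multiplication on the Hilbert space $M_n(\mathbb C)$ with inner product $(X,Y)=\operatorname{Tr} Y^*X$; they are commuting positive definite operators, and powers of positive operators on this Hilbert space are again defined by functional calculus. **Theorem (Carlen–Lieb).** The real-valued trace function $$(A,B)\mapsto \operatorname{Tr}\,(A^p+B^p)^{1/r}$$ is jointly concave on the set of pairs $(A,B)$ of positive definite $n\times n$ matrices. Moreover, for every complex $n\times n$ matrix $K$, the real-valued function $$(A,B)\mapsto \operatorname{Tr}\,K^*\,\bigl(L_A^p+R_B^p\bigr)^{1/r}(K)$$ is jointly concave on the same set. -/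

import Mathlib

open scoped Matrix MatrixOrder ComplexOrder

noncomputable section

/-- The space of complex `n × n` matrices, regarded as a Hilbert space with the
Hilbert–Schmidt inner product; as a vector space it is `Matrix n n ℂ`. -/
def HSMatrix (n : Type*) : Type _ := Matrix n n ℂ

namespace HSMatrix

variable {n : Type*}

instance instAddCommGroup : AddCommGroup (HSMatrix n) :=
  inferInstanceAs (AddCommGroup (Matrix n n ℂ))

instance instModule : Module ℂ (HSMatrix n) :=
  inferInstanceAs (Module ℂ (Matrix n n ℂ))

/-- The identity map from the Hilbert space of matrices to matrices. -/
def toMat : HSMatrix n ≃ₗ[ℂ] Matrix n n ℂ := LinearEquiv.refl ℂ (Matrix n n ℂ)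

variable [Fintype n]

/-- The inner product `⟪X, Y⟫ = Tr (X* Y)`, conjugate-linear in the first variable. -/
abbrev core : InnerProductSpace.Core ℂ (HSMatrix n) where
  inner X Y := Matrix.trace ((toMat X)ᴴ * toMat Y)
  conj_inner_symm X Y := by
    rw [starRingEnd_apply, ← Matrix.trace_conjTranspose, Matrix.conjTranspose_mul,
      Matrix.conjTranspose_conjTranspose]
  re_inner_nonneg X :=
    (Complex.nonneg_iff.mp (Matrix.posSemidef_conjTranspose_mul_self (toMat X)).trace_nonneg).1
  add_left X Y Z := by
    rw [map_add, Matrix.conjTranspose_add, Matrix.add_mul, Matrix.trace_add]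
  smul_left X Y c := by
    rw [map_smul, Matrix.conjTranspose_smul, Matrix.smul_mul, Matrix.trace_smul]
    rfl
  definite X h := toMat.map_eq_zero_iff.mp (Matrix.trace_conjTranspose_mul_self_eq_zero_iff.mp h)

instance instNormedAddCommGroup : NormedAddCommGroup (HSMatrix n) :=
  core.toNormedAddCommGroup

instance instInnerProductSpace : InnerProductSpace ℂ (HSMatrix n) :=
  InnerProductSpace.ofCore core.toCore

instance instFiniteDimensional : FiniteDimensional ℂ (HSMatrix n) :=
  inferInstanceAs (FiniteDimensional ℂ (Matrix n n ℂ))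

instance instCompleteSpace : CompleteSpace (HSMatrix n) :=
  FiniteDimensional.complete ℂ (HSMatrix n)

/-- Left multiplication `L_A : X ↦ A X`, a bounded operator on the Hilbert space of matrices. -/
def leftMul (A : Matrix n n ℂ) : HSMatrix n →L[ℂ] HSMatrix n :=
  LinearMap.toContinuousLinearMap
    (toMat.symm.toLinearMap ∘ₗ LinearMap.mulLeft ℂ A ∘ₗ toMat.toLinearMap)

/-- Right multiplication `R_B : X ↦ X B`, a bounded operator on the Hilbert space of matrices. -/
def rightMul (B : Matrix n n ℂ) : HSMatrix n →L[ℂ] HSMatrix n :=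
  LinearMap.toContinuousLinearMap
    (toMat.symm.toLinearMap ∘ₗ LinearMap.mulRight ℂ B ∘ₗ toMat.toLinearMap)

/-- The complex number `Tr (K* T(K))` for a linear operator `T` on matrices and a matrix `K`. -/
def traceForm (T : HSMatrix n →L[ℂ] HSMatrix n) (K : Matrix n n ℂ) : ℂ :=
  Matrix.trace (Kᴴ * toMat (T (toMat.symm K)))

end HSMatrix

/-- The pairs `(A, B)` of positive definite matrices. -/
def posDefPairs (n : Type*) [Fintype n] : Set (Matrix n n ℂ × Matrix n n ℂ) :=
  {X | X.1.PosDef ∧ X.2.PosDef}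

end

/-!
Both parts rest on one fact about a C⋆-algebra: for commuting strictly positive `x`, `y` the
weighted geometric mean `x ^ (1 - α) * y ^ α` is jointly superadditive and monotone
(`geomMean_superadditive`); commutation is needed only inside each pair, not across pairs. For
`α = 1 / 2` it follows from the fact that the mean is the largest `g ≥ 0` with `g * y⁻¹ * g ≤ x`,
together with the joint convexity of `g * y⁻¹ * g`. The set of admissible `α` is closed, stable
under midpoints and contains `0` and `1`, hence is all of `[0, 1]`.

The power mean `M = (l ^ p + r ^ p) ^ (1 / p)` with `0 < p ≤ 1` is the fixed point of
`X ↦ X ^ (1 - p) * l ^ p + X ^ (1 - p) * r ^ p`, a map that preserves joint superadditivity.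
Iterating it from `X = l` gives elements converging to `M`, so `M` is superadditive
(`powerMean_superadditive`). As `M` is homogeneous and `t ↦ t ^ (p / r)` is operator monotone and
operator concave, `(l ^ p + r ^ p) ^ (1 / r) = M ^ (p / r)` is jointly concave
(`rpow_add_rpow_rpow_concave`). For `l`, `r` the left and right multiplications on the
Hilbert–Schmidt space, this is the statement about the quadratic form at `K`.

For the trace function put `Y = A ^ p + B ^ p`. Young's inequality for the trace gives
that `r * Tr (Y ^ (1 / r))` is the maximum over `X > 0` of `Tr (Y * X ^ (1 - r)) - (1 - r) * Tr X`,
attained at `X = Y ^ (1 / r)`. Since `p + (1 - r) ≤ 1`, Lieb's concavity theorem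
(`trace_rpow_mul_rpow_concave`, again a consequence of `geomMean_superadditive` for left and right
multiplications) makes the expression to be maximized jointly concave in `(A, B, X)`, and a
maximum over `X` of a jointly concave function is concave in `(A, B)`.
-/

open Filter Topology Set

/-! ### Real powers of commuting strictly positive elements -/

section CStarAlgebra

variable {A : Type*} [CStarAlgebra A] [PartialOrder A] [StarOrderedRing A]

namespace CFC

lemma rpow_eq_exp_smul_log {a : A} (ha : IsStrictlyPositive a) (s : ℝ) :
    a ^ s = NormedSpace.exp (s • CFC.log a) := by
  have hpos : ∀ x ∈ spectrum ℝ a, 0 < x := by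
    rwa [← StarOrderedRing.isStrictlyPositive_iff_spectrum_pos a ha.isSelfAdjoint]
  have hlog : ContinuousOn Real.log (spectrum ℝ a) :=
    Real.continuousOn_log.mono fun x hx => (hpos x hx).ne'
  rw [rpow_eq_cfc_real ha.nonneg, CFC.log, ← cfc_smul s Real.log a hlog,
    ← CFC.real_exp_eq_normedSpace_exp, ← cfc_comp' Real.exp (fun x => s • Real.log x) a
      (by fun_prop) (hlog.const_smul s)]
  refine cfc_congr fun x hx => ?_
  rw [Real.rpow_def_of_pos (hpos x hx), smul_eq_mul, mul_comm]

lemma rpow_neg_one_mul_self {a : A} (ha : IsStrictlyPositive a) : a ^ (-1 : ℝ) * a = 1 := by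
  simpa [rpow_one a ha.nonneg] using rpow_neg_mul_rpow (a := a) 1 ha

lemma self_mul_rpow_neg_one {a : A} (ha : IsStrictlyPositive a) : a * a ^ (-1 : ℝ) = 1 := by
  simpa [rpow_one a ha.nonneg] using rpow_mul_rpow_neg (a := a) 1 ha

lemma continuous_const_rpow {a : A} (ha : IsStrictlyPositive a) :
    Continuous fun s : ℝ => a ^ s := by
  let _ : NormedAlgebra ℚ A := NormedAlgebra.restrictScalars ℚ ℝ A
  simp_rw [rpow_eq_exp_smul_log ha]
  exact NormedSpace.exp_continuous.comp (by fun_prop)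

end CFC

lemma Commute.rpow_left {a b : A} (h : Commute a b) (s : ℝ) : Commute (a ^ s) b :=
  h.cfc_nnreal _

lemma Commute.rpow_right {a b : A} (h : Commute a b) (s : ℝ) : Commute a (b ^ s) :=
  (h.symm.rpow_left s).symm

lemma Commute.isStrictlyPositive_mul {a b : A} (h : Commute a b) (ha : IsStrictlyPositive a)
    (hb : IsStrictlyPositive b) : IsStrictlyPositive (a * b) :=
  (ha.commute_iff hb).mp h

/-- Powers are multiplicative on commuting strictly positive elements, because logarithms of such
elements add. -/
lemma Commute.mul_rpow {a b : A} (h : Commute a b) (ha : IsStrictlyPositive a)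
    (hb : IsStrictlyPositive b) (s : ℝ) : (a * b) ^ s = a ^ s * b ^ s := by
  let _ : NormedAlgebra ℚ A := NormedAlgebra.restrictScalars ℚ ℝ A
  have hl : Commute (CFC.log a) (CFC.log b) :=
    ((h.cfc_real Real.log).symm.cfc_real Real.log).symm
  have hlog : CFC.log (a * b) = CFC.log a + CFC.log b := by
    rw [← CFC.log_exp (CFC.log a + CFC.log b) (IsSelfAdjoint.log.add IsSelfAdjoint.log),
      NormedSpace.exp_add_of_commute hl, CFC.exp_log a ha, CFC.exp_log b hb]
  rw [CFC.rpow_eq_exp_smul_log (h.isStrictlyPositive_mul ha hb), hlog, smul_add,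
    NormedSpace.exp_add_of_commute ((hl.smul_left s).smul_right s),
    ← CFC.rpow_eq_exp_smul_log ha, ← CFC.rpow_eq_exp_smul_log hb]

lemma IsStrictlyPositive.smul_pos {a : A} (ha : IsStrictlyPositive a) {c : ℝ} (hc : 0 < c) :
    IsStrictlyPositive (c • a) :=
  ⟨smul_nonneg hc.le ha.nonneg, (ha.isUnit.smul (Units.mk0 c hc.ne'))⟩

lemma CFC.smul_rpow {a : A} (ha : IsStrictlyPositive a) {c : ℝ} (hc : 0 < c) (s : ℝ) :
    (c • a) ^ s = c ^ s • a ^ s := by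
  have h1 : IsStrictlyPositive (algebraMap ℝ A c) := by
    rw [Algebra.algebraMap_eq_smul_one]; exact isStrictlyPositive_one.smul_pos hc
  have h2 : (algebraMap ℝ A c) ^ s = algebraMap ℝ A (c ^ s) := by
    rw [CFC.rpow_eq_cfc_real h1.nonneg, cfc_algebraMap]
  rw [Algebra.smul_def, Commute.mul_rpow (Algebra.commutes c a) h1 ha, h2,
    ← Algebra.smul_def]

lemma Commute.rpow_rpow {a b : A} (h : Commute a b) (s t : ℝ) : Commute (a ^ s) (b ^ t) :=
  (h.rpow_left s).rpow_right t

lemma IsStrictlyPositive.rpow_rpow {a : A} (ha : IsStrictlyPositive a) (s t : ℝ) :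
    (a ^ s) ^ t = a ^ (s * t) := by
  rcases eq_or_ne s 0 with rfl | hs
  · simp [CFC.rpow_zero a ha.nonneg]
  · exact CFC.rpow_rpow a s t hs ha

lemma Commute.isStrictlyPositive_rpow_mul_rpow {x y : A} (h : Commute x y)
    (hx : IsStrictlyPositive x) (hy : IsStrictlyPositive y) (s t : ℝ) :
    IsStrictlyPositive (x ^ s * y ^ t) :=
  (h.rpow_rpow s t).isStrictlyPositive_mul (hx.rpow x s) (hy.rpow y t)

lemma Commute.rpow_mul_rpow_rpow {x y : A} (h : Commute x y) (hx : IsStrictlyPositive x)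
    (hy : IsStrictlyPositive y) (s t c : ℝ) :
    (x ^ s * y ^ t) ^ c = x ^ (s * c) * y ^ (t * c) := by
  rw [(h.rpow_rpow s t).mul_rpow (hx.rpow x s) (hy.rpow y t), hx.rpow_rpow, hy.rpow_rpow]

lemma Commute.rpow_mul_rpow_mul {x y : A} (h : Commute x y) (hx : IsStrictlyPositive x)
    (hy : IsStrictlyPositive y) (s t u v : ℝ) :
    (x ^ s * y ^ t) * (x ^ u * y ^ v) = x ^ (s + u) * y ^ (t + v) := by
  rw [CFC.rpow_add hx.isUnit, CFC.rpow_add hy.isUnit, (h.symm.rpow_rpow t u).mul_mul_mul_comm]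

/-! ### Superadditivity of weighted geometric means -/

/-- Joint convexity and monotonicity of `(g, y) ↦ g * y⁻¹ * g`, with the upper bounds built in. -/
lemma conj_rpow_neg_one_le {x₁ x₂ x y₁ y₂ y g₁ g₂ : A} (hy₁ : IsStrictlyPositive y₁)
    (hy₂ : IsStrictlyPositive y₂) (hy : IsStrictlyPositive y) (hg₁ : IsSelfAdjoint g₁)
    (hg₂ : IsSelfAdjoint g₂) (h₁ : g₁ * y₁ ^ (-1 : ℝ) * g₁ ≤ x₁)
    (h₂ : g₂ * y₂ ^ (-1 : ℝ) * g₂ ≤ x₂) (hx : x₁ + x₂ ≤ x) (hyy : y₁ + y₂ ≤ y) :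
    (g₁ + g₂) * y ^ (-1 : ℝ) * (g₁ + g₂) ≤ x := by
  have key : ∀ {z g h : A}, IsStrictlyPositive z → IsSelfAdjoint g →
      g * h + star h * g - star h * z * h ≤ g * z ^ (-1 : ℝ) * g := by
    intro z g h hz hg
    -- The difference of the two sides is `(g - z * h)⋆ * z⁻¹ * (g - z * h)`.
    have := star_left_conjugate_nonneg (CFC.rpow_nonneg (a := z) (y := -1)) (g - z * h)
    rw [← sub_nonneg]
    convert this using 1
    have e1 : star (g - z * h) = g - star h * z := by
      rw [star_sub, star_mul, hg.star_eq, hz.isSelfAdjoint.star_eq]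
    rw [e1]
    simp only [sub_mul, mul_sub, mul_assoc]
    rw [← mul_assoc (z ^ (-1 : ℝ)) z h, CFC.rpow_neg_one_mul_self hz,
      ← mul_assoc z (z ^ (-1 : ℝ)) g, CFC.self_mul_rpow_neg_one hz]
    simp only [one_mul]
    abel
  -- This `h` makes the affine lower bound of `key` exact at `z = y`, `g = g₁ + g₂`.
  set h := y ^ (-1 : ℝ) * (g₁ + g₂) with hh
  have hsh : star h = (g₁ + g₂) * y ^ (-1 : ℝ) := by
    rw [hh, star_mul, (hg₁.add hg₂).star_eq,
      (IsSelfAdjoint.of_nonneg (CFC.rpow_nonneg (a := y) (y := -1))).star_eq]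
  have e : star h * y * h = star h * (g₁ + g₂) := by
    rw [hsh, mul_assoc _ _ y, CFC.rpow_neg_one_mul_self hy, mul_one, hh, mul_assoc]
  have k3 := star_left_conjugate_le_conjugate hyy h
  calc (g₁ + g₂) * y ^ (-1 : ℝ) * (g₁ + g₂)
      = (g₁ * h + star h * g₁) + (g₂ * h + star h * g₂) - star h * y * h := by
        rw [e, hsh, hh]; noncomm_ring
    _ ≤ (g₁ * h + star h * g₁) + (g₂ * h + star h * g₂) - star h * (y₁ + y₂) * h := by
        gcongr
    _ = (g₁ * h + star h * g₁ - star h * y₁ * h)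
          + (g₂ * h + star h * g₂ - star h * y₂ * h) := by noncomm_ring
    _ ≤ g₁ * y₁ ^ (-1 : ℝ) * g₁ + g₂ * y₂ ^ (-1 : ℝ) * g₂ := add_le_add (key hy₁ hg₁) (key hy₂ hg₂)
    _ ≤ x := (add_le_add h₁ h₂).trans hx

/-- The geometric mean of commuting `x` and `y` dominates every `g ≥ 0` with `g * y⁻¹ * g ≤ x`:
conjugating by `y ^ (-1 / 2)` turns the hypothesis into a bound on a square, to which operator
monotonicity of the square root applies. -/
lemma le_rpow_half_of_conj_le {x y g : A} (hx : IsStrictlyPositive x) (hy : IsStrictlyPositive y)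
    (hxy : Commute x y) (hg : 0 ≤ g) (h : g * y ^ (-1 : ℝ) * g ≤ x) :
    g ≤ (x * y) ^ (1 / 2 : ℝ) := by
  set c := y ^ (-(1 / 2) : ℝ) with hc
  set d := y ^ (1 / 2 : ℝ) with hd
  have hcsa : IsSelfAdjoint c := IsSelfAdjoint.of_nonneg CFC.rpow_nonneg
  have hdsa : IsSelfAdjoint d := IsSelfAdjoint.of_nonneg CFC.rpow_nonneg
  have hcc : c * c = y ^ (-1 : ℝ) := by
    rw [hc, ← CFC.rpow_add hy.isUnit]; norm_num
  have hcd : c * d = 1 := CFC.rpow_neg_mul_rpow (a := y) (1 / 2) hy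
  have hdc : d * c = 1 := CFC.rpow_mul_rpow_neg (a := y) (1 / 2) hy
  have hxc : Commute x c := hxy.rpow_right _
  have hxd : Commute x d := hxy.rpow_right _
  have hy1 : IsStrictlyPositive (y ^ (-1 : ℝ)) := hy.rpow y (-1)
  have h1 : (c * g * c) ^ (2 : ℝ) ≤ x * y ^ (-1 : ℝ) := by
    have := star_left_conjugate_le_conjugate h c
    rw [hcsa.star_eq] at this
    have h0 : 0 ≤ c * g * c := by
      simpa [hcsa.star_eq] using star_left_conjugate_nonneg hg c
    calc (c * g * c) ^ (2 : ℝ) = c * (g * y ^ (-1 : ℝ) * g) * c := by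
          have := CFC.rpow_natCast (c * g * c) 2 h0
          rw [Nat.cast_ofNat] at this
          rw [this, ← hcc, pow_two]; simp only [mul_assoc]
      _ ≤ c * x * c := this
      _ = x * y ^ (-1 : ℝ) := by rw [← hxc.eq, mul_assoc, hcc]
  have h2 : c * g * c ≤ (x * y ^ (-1 : ℝ)) ^ (1 / 2 : ℝ) := by
    have h0 : 0 ≤ c * g * c := by
      simpa [hcsa.star_eq] using star_left_conjugate_nonneg hg c
    have := CFC.rpow_le_rpow (p := 1 / 2) ⟨by norm_num, by norm_num⟩ h1
    rwa [CFC.rpow_rpow_of_exponent_nonneg _ _ _ (by norm_num) (by norm_num) h0,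
      show (2 : ℝ) * (1 / 2) = 1 by norm_num, CFC.rpow_one _ h0] at this
  have h3 := star_left_conjugate_le_conjugate h2 d
  rw [hdsa.star_eq] at h3
  have e1 : d * (c * g * c) * d = g := by
    rw [mul_assoc c g c, ← mul_assoc d c, hdc, one_mul, mul_assoc, hcd, mul_one]
  rw [e1, (hxy.rpow_right (-1)).mul_rpow hx hy1, CFC.rpow_rpow _ _ _ (by norm_num) hy] at h3
  refine h3.trans_eq ?_
  rw [hxy.mul_rpow hx hy, ← hd, show (-1 : ℝ) * (1 / 2) = -(1 / 2) by norm_num, ← hc]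
  rw [← mul_assoc, ← ((hxd.rpow_left (1 / 2)).eq), mul_assoc, mul_assoc, hcd, mul_one]

/-- Superadditivity of the geometric mean, with upper bounds `x`, `y` in place of the sums. The two
pairs need not commute with each other. -/
theorem geomMean_half_superadditive {x₁ x₂ x y₁ y₂ y : A}
    (hx₁ : IsStrictlyPositive x₁) (hy₁ : IsStrictlyPositive y₁) (h₁ : Commute x₁ y₁)
    (hx₂ : IsStrictlyPositive x₂) (hy₂ : IsStrictlyPositive y₂) (h₂ : Commute x₂ y₂)
    (hx : IsStrictlyPositive x) (hy : IsStrictlyPositive y) (h : Commute x y)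
    (hxx : x₁ + x₂ ≤ x) (hyy : y₁ + y₂ ≤ y) :
    (x₁ * y₁) ^ (1 / 2 : ℝ) + (x₂ * y₂) ^ (1 / 2 : ℝ) ≤ (x * y) ^ (1 / 2 : ℝ) := by
  have key : ∀ {u v : A}, IsStrictlyPositive u → IsStrictlyPositive v → Commute u v →
      (u * v) ^ (1 / 2 : ℝ) * v ^ (-1 : ℝ) * (u * v) ^ (1 / 2 : ℝ) ≤ u := by
    intro u v hu hv huv
    have hc : Commute ((u * v) ^ (1 / 2 : ℝ)) (v ^ (-1 : ℝ)) :=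
      ((huv.mul_left (Commute.refl v)).rpow_left _).rpow_right _
    have huv' := huv.isStrictlyPositive_mul hu hv
    rw [mul_assoc, ← hc.eq, ← mul_assoc, ← CFC.rpow_add huv'.isUnit,
      show (1 / 2 : ℝ) + 1 / 2 = 1 by norm_num, CFC.rpow_one _ huv'.nonneg, mul_assoc]
    rw [CFC.self_mul_rpow_neg_one hv, mul_one]
  exact le_rpow_half_of_conj_le hx hy h (add_nonneg CFC.rpow_nonneg CFC.rpow_nonneg)
    (conj_rpow_neg_one_le hy₁ hy₂ hy (.of_nonneg CFC.rpow_nonneg) (.of_nonneg CFC.rpow_nonneg)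
      (key hx₁ hy₁ h₁) (key hx₂ hy₂ h₂) hxx hyy)

/-- A closed set of reals that contains `0` and `1` and is stable under midpoints contains
`[0, 1]`. -/
lemma IsClosed.Icc_subset_of_midpoint_mem {s : Set ℝ} (hs : IsClosed s) (h0 : (0 : ℝ) ∈ s)
    (h1 : (1 : ℝ) ∈ s) (hmid : ∀ a ∈ s, ∀ b ∈ s, (a + b) / 2 ∈ s) : Icc (0 : ℝ) 1 ⊆ s := by
  refine IsClosed.Icc_subset_of_forall_exists_gt (hs.inter isClosed_Icc) h0 ?_
  rintro a ⟨ha, ha0, ha1⟩ b hb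
  -- Repeated bisection between `a` and `1` produces points of `s` just above `a`.
  have hmem : ∀ k : ℕ, a + (1 - a) * (1 / 2) ^ k ∈ s := by
    intro k
    induction k with
    | zero => simpa using h1
    | succ k ih =>
      convert hmid _ ha _ ih using 1
      ring
  have hlim : Tendsto (fun k : ℕ => a + (1 - a) * (1 / 2) ^ k) atTop (𝓝 a) := by
    simpa using ((tendsto_pow_atTop_nhds_zero_of_lt_one (r := (1 / 2 : ℝ)) (by norm_num)
      (by norm_num)).const_mul (1 - a)).const_add a
  obtain ⟨k, hk⟩ := (hlim.eventually (gt_mem_nhds (show a < b from hb))).exists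
  exact ⟨_, hmem k, lt_add_of_pos_right _ (mul_pos (by linarith) (by positivity)), hk.le⟩

/-- The geometric mean of two weighted geometric means has the averaged weight. -/
lemma geomMean_mul_geomMean {x y : A} (hx : IsStrictlyPositive x) (hy : IsStrictlyPositive y)
    (h : Commute x y) (α β : ℝ) :
    ((x ^ (1 - α) * y ^ α) * (x ^ (1 - β) * y ^ β)) ^ (1 / 2 : ℝ)
      = x ^ (1 - (α + β) / 2) * y ^ ((α + β) / 2) := by
  rw [h.rpow_mul_rpow_mul hx hy, h.rpow_mul_rpow_rpow hx hy]
  congr 2 <;> ring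

/-- Weighted geometric means of commuting elements are jointly superadditive and monotone. The two
pairs need not commute with each other. -/
theorem geomMean_superadditive {x₁ x₂ x y₁ y₂ y : A}
    (hx₁ : IsStrictlyPositive x₁) (hy₁ : IsStrictlyPositive y₁) (h₁ : Commute x₁ y₁)
    (hx₂ : IsStrictlyPositive x₂) (hy₂ : IsStrictlyPositive y₂) (h₂ : Commute x₂ y₂)
    (hx : IsStrictlyPositive x) (hy : IsStrictlyPositive y) (h : Commute x y)
    (hxx : x₁ + x₂ ≤ x) (hyy : y₁ + y₂ ≤ y) {α : ℝ} (hα : α ∈ Icc (0 : ℝ) 1) :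
    x₁ ^ (1 - α) * y₁ ^ α + x₂ ^ (1 - α) * y₂ ^ α ≤ x ^ (1 - α) * y ^ α := by
  have hcont : ∀ {u v : A}, IsStrictlyPositive u → IsStrictlyPositive v →
      Continuous fun s : ℝ => u ^ (1 - s) * v ^ s := fun hu hv =>
    ((CFC.continuous_const_rpow hu).comp (by fun_prop)).mul (CFC.continuous_const_rpow hv)
  have hsp : ∀ {u v : A}, IsStrictlyPositive u → IsStrictlyPositive v → Commute u v → ∀ s : ℝ,
      IsStrictlyPositive (u ^ (1 - s) * v ^ s) := fun hu hv huv s =>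
    huv.isStrictlyPositive_rpow_mul_rpow hu hv _ _
  have hcomm : ∀ {u v : A}, Commute u v → ∀ s t : ℝ,
      Commute (u ^ (1 - s) * v ^ s) (u ^ (1 - t) * v ^ t) := fun huv s t =>
    (((Commute.refl _).rpow_rpow _ _).mul_right (huv.rpow_rpow _ _)).mul_left
      ((huv.symm.rpow_rpow _ _).mul_right ((Commute.refl _).rpow_rpow _ _))
  refine IsClosed.Icc_subset_of_midpoint_mem (s := {s : ℝ | x₁ ^ (1 - s) * y₁ ^ s
    + x₂ ^ (1 - s) * y₂ ^ s ≤ x ^ (1 - s) * y ^ s})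
    (isClosed_le ((hcont hx₁ hy₁).add (hcont hx₂ hy₂)) (hcont hx hy)) ?_ ?_ ?_ hα
  · simpa [CFC.rpow_zero _ hy₁.nonneg, CFC.rpow_zero _ hy₂.nonneg, CFC.rpow_zero _ hy.nonneg,
      CFC.rpow_one _ hx₁.nonneg, CFC.rpow_one _ hx₂.nonneg, CFC.rpow_one _ hx.nonneg] using hxx
  · simpa [CFC.rpow_zero _ hx₁.nonneg, CFC.rpow_zero _ hx₂.nonneg, CFC.rpow_zero _ hx.nonneg,
      CFC.rpow_one _ hy₁.nonneg, CFC.rpow_one _ hy₂.nonneg, CFC.rpow_one _ hy.nonneg] using hyy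
  · intro s hs t ht
    have := geomMean_half_superadditive (hsp hx₁ hy₁ h₁ s) (hsp hx₁ hy₁ h₁ t) (hcomm h₁ s t)
      (hsp hx₂ hy₂ h₂ s) (hsp hx₂ hy₂ h₂ t) (hcomm h₂ s t)
      (hsp hx hy h s) (hsp hx hy h t) (hcomm h s t) hs ht
    rwa [geomMean_mul_geomMean hx₁ hy₁ h₁, geomMean_mul_geomMean hx₂ hy₂ h₂,
      geomMean_mul_geomMean hx hy h] at this

/-! ### Power means and joint concavity -/

/-- The iterates of `X ↦ X ^ (1 - p) * l ^ p + X ^ (1 - p) * r ^ p` started at `X = l` are jointly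
superadditive. With `ε = (1 - p) ^ k`, the `k`-th iterate is
`l ^ ε * (l ^ p + r ^ p) ^ ((1 - ε) / p)`. -/
lemma powerMean_interpolation_superadditive {l₁ r₁ l₂ r₂ l r : A}
    (hl₁ : IsStrictlyPositive l₁) (hr₁ : IsStrictlyPositive r₁) (h₁ : Commute l₁ r₁)
    (hl₂ : IsStrictlyPositive l₂) (hr₂ : IsStrictlyPositive r₂) (h₂ : Commute l₂ r₂)
    (hl : IsStrictlyPositive l) (hr : IsStrictlyPositive r) (h : Commute l r)
    (hll : l₁ + l₂ ≤ l) (hrr : r₁ + r₂ ≤ r) {p : ℝ} (hp : 0 < p) (hp1 : p ≤ 1) (k : ℕ) :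
    l₁ ^ ((1 - p) ^ k) * (l₁ ^ p + r₁ ^ p) ^ ((1 - (1 - p) ^ k) / p)
      + l₂ ^ ((1 - p) ^ k) * (l₂ ^ p + r₂ ^ p) ^ ((1 - (1 - p) ^ k) / p)
      ≤ l ^ ((1 - p) ^ k) * (l ^ p + r ^ p) ^ ((1 - (1 - p) ^ k) / p) := by
  have hT : ∀ {u v : A}, IsStrictlyPositive u → IsStrictlyPositive v →
      IsStrictlyPositive (u ^ p + v ^ p) := fun hu hv =>
    (hu.rpow _ p).add_nonneg (hv.rpow _ p).nonneg
  have hlT : ∀ {u v : A}, Commute u v → Commute u (u ^ p + v ^ p) := fun huv =>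
    ((Commute.refl _).rpow_right p).add_right (huv.rpow_right p)
  have hrT : ∀ {u v : A}, Commute u v → Commute v (u ^ p + v ^ p) := fun huv =>
    (huv.symm.rpow_right p).add_right ((Commute.refl _).rpow_right p)
  induction k with
  | zero =>
    simpa [CFC.rpow_zero _ (hT hl₁ hr₁).nonneg, CFC.rpow_zero _ (hT hl₂ hr₂).nonneg,
      CFC.rpow_zero _ (hT hl hr).nonneg, CFC.rpow_one _ hl₁.nonneg, CFC.rpow_one _ hl₂.nonneg,
      CFC.rpow_one _ hl.nonneg] using hll
  | succ k ih =>
    rw [pow_succ]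
    generalize (1 - p) ^ k = ε at ih ⊢
    have hU : ∀ {u v : A}, IsStrictlyPositive u → IsStrictlyPositive v → Commute u v →
        IsStrictlyPositive (u ^ ε * (u ^ p + v ^ p) ^ ((1 - ε) / p)) := fun hu hv huv =>
      (hlT huv).isStrictlyPositive_rpow_mul_rpow hu (hT hu hv) _ _
    have hUl : ∀ {u v : A}, Commute u v →
        Commute (u ^ ε * (u ^ p + v ^ p) ^ ((1 - ε) / p)) u := fun huv =>
      ((Commute.refl _).rpow_left _).mul_left ((hlT huv).symm.rpow_left _)
    have hUr : ∀ {u v : A}, Commute u v →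
        Commute (u ^ ε * (u ^ p + v ^ p) ^ ((1 - ε) / p)) v := fun huv =>
      (huv.rpow_left _).mul_left ((hrT huv).symm.rpow_left _)
    -- One step of the iteration, in closed form.
    have hrec : ∀ {u v : A}, IsStrictlyPositive u → IsStrictlyPositive v → Commute u v →
        u ^ (ε * (1 - p)) * (u ^ p + v ^ p) ^ ((1 - ε * (1 - p)) / p)
          = (u ^ ε * (u ^ p + v ^ p) ^ ((1 - ε) / p)) ^ (1 - p) * u ^ p
            + (u ^ ε * (u ^ p + v ^ p) ^ ((1 - ε) / p)) ^ (1 - p) * v ^ p := by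
      intro u v hu hv huv
      rw [← mul_add, (hlT huv).rpow_mul_rpow_rpow hu (hT hu hv), mul_assoc]
      congr 1
      nth_rw 3 [← CFC.rpow_one (u ^ p + v ^ p) (hT hu hv).nonneg]
      rw [← CFC.rpow_add (hT hu hv).isUnit]
      congr 1
      field_simp
      ring
    rw [hrec hl₁ hr₁ h₁, hrec hl₂ hr₂ h₂, hrec hl hr h, add_add_add_comm]
    exact add_le_add
      (geomMean_superadditive (hU hl₁ hr₁ h₁) hl₁ (hUl h₁) (hU hl₂ hr₂ h₂) hl₂ (hUl h₂)
        (hU hl hr h) hl (hUl h) ih hll ⟨hp.le, hp1⟩)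
      (geomMean_superadditive (hU hl₁ hr₁ h₁) hr₁ (hUr h₁) (hU hl₂ hr₂ h₂) hr₂ (hUr h₂)
        (hU hl hr h) hr (hUr h) ih hrr ⟨hp.le, hp1⟩)

/-- Power means `(l ^ p + r ^ p) ^ (1 / p)` with `0 < p ≤ 1` of commuting elements are jointly
superadditive, as limits of the iterates in `powerMean_interpolation_superadditive`. -/
theorem powerMean_superadditive {l₁ r₁ l₂ r₂ l r : A}
    (hl₁ : IsStrictlyPositive l₁) (hr₁ : IsStrictlyPositive r₁) (h₁ : Commute l₁ r₁)
    (hl₂ : IsStrictlyPositive l₂) (hr₂ : IsStrictlyPositive r₂) (h₂ : Commute l₂ r₂)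
    (hl : IsStrictlyPositive l) (hr : IsStrictlyPositive r) (h : Commute l r)
    (hll : l₁ + l₂ ≤ l) (hrr : r₁ + r₂ ≤ r) {p : ℝ} (hp : 0 < p) (hp1 : p ≤ 1) :
    (l₁ ^ p + r₁ ^ p) ^ (1 / p) + (l₂ ^ p + r₂ ^ p) ^ (1 / p) ≤ (l ^ p + r ^ p) ^ (1 / p) := by
  have hlim : ∀ {u v : A}, IsStrictlyPositive u → IsStrictlyPositive v →
      Tendsto (fun k : ℕ => u ^ ((1 - p) ^ k) * (u ^ p + v ^ p) ^ ((1 - (1 - p) ^ k) / p)) atTop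
        (𝓝 ((u ^ p + v ^ p) ^ (1 / p))) := by
    intro u v hu hv
    have hT := (hu.rpow u p).add_nonneg (hv.rpow v p).nonneg
    have hcont : Continuous fun ε : ℝ => u ^ ε * (u ^ p + v ^ p) ^ ((1 - ε) / p) :=
      (CFC.continuous_const_rpow hu).mul ((CFC.continuous_const_rpow hT).comp (by fun_prop))
    have hpow : Tendsto (fun k : ℕ => (1 - p) ^ k) atTop (𝓝 0) :=
      tendsto_pow_atTop_nhds_zero_of_lt_one (by linarith) (by linarith)
    have := (hcont.tendsto 0).comp hpow
    rwa [CFC.rpow_zero u hu.nonneg, one_mul, sub_zero] at this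
  exact le_of_tendsto_of_tendsto' ((hlim hl₁ hr₁).add (hlim hl₂ hr₂)) (hlim hl hr)
    fun k => powerMean_interpolation_superadditive hl₁ hr₁ h₁ hl₂ hr₂ h₂ hl hr h hll hrr hp hp1 k

lemma smul_add_smul_rpow_le {m₁ m₂ m : A} (hm₁ : 0 ≤ m₁) (hm₂ : 0 ≤ m₂) {a b : ℝ}
    (ha : 0 ≤ a) (hb : 0 ≤ b) (hab : a + b = 1) (hm : a • m₁ + b • m₂ ≤ m) {q : ℝ}
    (hq : q ∈ Icc (0 : ℝ) 1) : a • m₁ ^ q + b • m₂ ^ q ≤ m ^ q :=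
  ((CFC.concaveOn_rpow hq).2 hm₁ hm₂ ha hb hab).trans (CFC.rpow_le_rpow hq hm)

/-- For commuting `l`, `r` and `0 < p ≤ s ≤ 1` the element `(l ^ p + r ^ p) ^ (1 / s)` is jointly
operator concave: it is the power `p / s` of a homogeneous superadditive power mean. -/
theorem rpow_add_rpow_rpow_concave {l₁ r₁ l₂ r₂ : A}
    (hl₁ : IsStrictlyPositive l₁) (hr₁ : IsStrictlyPositive r₁) (h₁ : Commute l₁ r₁)
    (hl₂ : IsStrictlyPositive l₂) (hr₂ : IsStrictlyPositive r₂) (h₂ : Commute l₂ r₂)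
    {a b : ℝ} (ha : 0 < a) (hb : 0 < b) (hab : a + b = 1)
    (h : Commute (a • l₁ + b • l₂) (a • r₁ + b • r₂))
    {p s : ℝ} (hp : 0 < p) (hps : p ≤ s) (hs : s ≤ 1) :
    a • (l₁ ^ p + r₁ ^ p) ^ (1 / s) + b • (l₂ ^ p + r₂ ^ p) ^ (1 / s)
      ≤ ((a • l₁ + b • l₂) ^ p + (a • r₁ + b • r₂) ^ p) ^ (1 / s) := by
  have hs0 : 0 < s := hp.trans_le hps
  have hT : ∀ {u v : A}, IsStrictlyPositive u → IsStrictlyPositive v →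
      IsStrictlyPositive (u ^ p + v ^ p) := fun hu hv =>
    (hu.rpow _ p).add_nonneg (hv.rpow _ p).nonneg
  have hhom : ∀ {u v : A} {c : ℝ}, IsStrictlyPositive u → IsStrictlyPositive v → 0 < c →
      ((c • u) ^ p + (c • v) ^ p) ^ (1 / p) = c • (u ^ p + v ^ p) ^ (1 / p) := by
    intro u v c hu hv hc
    rw [CFC.smul_rpow hu hc, CFC.smul_rpow hv hc, ← smul_add,
      CFC.smul_rpow (hT hu hv) (Real.rpow_pos_of_pos hc p), ← Real.rpow_mul hc.le,
      mul_one_div_cancel hp.ne', Real.rpow_one]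
  have hexp : ∀ {u v : A}, IsStrictlyPositive u → IsStrictlyPositive v →
      (u ^ p + v ^ p) ^ (1 / s) = ((u ^ p + v ^ p) ^ (1 / p)) ^ (p / s) := by
    intro u v hu hv
    rw [(hT hu hv).rpow_rpow, one_div_mul_eq_div, div_div_cancel_left' hp.ne', one_div]
  have hl := (hl₁.smul_pos ha).add_nonneg (hl₂.smul_pos hb).nonneg
  have hr := (hr₁.smul_pos ha).add_nonneg (hr₂.smul_pos hb).nonneg
  have key := powerMean_superadditive (hl₁.smul_pos ha) (hr₁.smul_pos ha)
    ((h₁.smul_left a).smul_right a) (hl₂.smul_pos hb) (hr₂.smul_pos hb)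
    ((h₂.smul_left b).smul_right b) hl hr h le_rfl le_rfl hp (hps.trans hs)
  rw [hhom hl₁ hr₁ ha, hhom hl₂ hr₂ hb] at key
  rw [hexp hl₁ hr₁, hexp hl₂ hr₂, hexp hl hr]
  exact smul_add_smul_rpow_le CFC.rpow_nonneg CFC.rpow_nonneg ha.le hb.le hab key
    ⟨by positivity, (div_le_one hs0).mpr hps⟩

/-- For commuting `x`, `y` and `p + q ≤ 1` the product `x ^ p * y ^ q` is jointly operator concave:
it is the power `p + q` of a weighted geometric mean. -/
theorem rpow_mul_rpow_concave {x₁ y₁ x₂ y₂ : A}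
    (hx₁ : IsStrictlyPositive x₁) (hy₁ : IsStrictlyPositive y₁) (h₁ : Commute x₁ y₁)
    (hx₂ : IsStrictlyPositive x₂) (hy₂ : IsStrictlyPositive y₂) (h₂ : Commute x₂ y₂)
    {a b : ℝ} (ha : 0 < a) (hb : 0 < b) (hab : a + b = 1)
    (h : Commute (a • x₁ + b • x₂) (a • y₁ + b • y₂))
    {p q : ℝ} (hp : 0 < p) (hq : 0 ≤ q) (hpq : p + q ≤ 1) :
    a • (x₁ ^ p * y₁ ^ q) + b • (x₂ ^ p * y₂ ^ q)
      ≤ (a • x₁ + b • x₂) ^ p * (a • y₁ + b • y₂) ^ q := by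
  have hpq0 : 0 < p + q := by positivity
  set α := q / (p + q) with hα
  have hα1 : (1 - α) * (p + q) = p := by rw [hα]; field_simp; ring
  have hα2 : α * (p + q) = q := by rw [hα]; field_simp
  have hhom : ∀ {u v : A} {c : ℝ}, IsStrictlyPositive u → IsStrictlyPositive v → 0 < c →
      (c • u) ^ (1 - α) * (c • v) ^ α = c • (u ^ (1 - α) * v ^ α) := by
    intro u v c hu hv hc
    rw [CFC.smul_rpow hu hc, CFC.smul_rpow hv hc, smul_mul_smul_comm, ← Real.rpow_add hc,
      sub_add_cancel, Real.rpow_one]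
  have hexp : ∀ {u v : A}, IsStrictlyPositive u → IsStrictlyPositive v → Commute u v →
      u ^ p * v ^ q = (u ^ (1 - α) * v ^ α) ^ (p + q) := by
    intro u v hu hv huv
    rw [huv.rpow_mul_rpow_rpow hu hv, hα1, hα2]
  have hx := (hx₁.smul_pos ha).add_nonneg (hx₂.smul_pos hb).nonneg
  have hy := (hy₁.smul_pos ha).add_nonneg (hy₂.smul_pos hb).nonneg
  have key := geomMean_superadditive (hx₁.smul_pos ha) (hy₁.smul_pos ha)
    ((h₁.smul_left a).smul_right a) (hx₂.smul_pos hb) (hy₂.smul_pos hb)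
    ((h₂.smul_left b).smul_right b) hx hy h le_rfl le_rfl (α := α)
    ⟨by positivity, (div_le_one hpq0).mpr (by linarith)⟩
  rw [hhom hx₁ hy₁ ha, hhom hx₂ hy₂ hb] at key
  rw [hexp hx₁ hy₁ h₁, hexp hx₂ hy₂ h₂, hexp hx hy h]
  exact smul_add_smul_rpow_le (h₁.isStrictlyPositive_rpow_mul_rpow hx₁ hy₁ _ _).nonneg
    (h₂.isStrictlyPositive_rpow_mul_rpow hx₂ hy₂ _ _).nonneg ha.le hb.le hab key ⟨hpq0.le, hpq⟩

/-- Bernoulli's inequality in the functional calculus. -/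
lemma rpow_le_smul_add {a : A} (ha : IsStrictlyPositive a) {r : ℝ} (hr : r ∈ Icc (0 : ℝ) 1) :
    a ^ r ≤ r • a + (1 - r) • (1 : A) := by
  have hpos : ∀ x ∈ spectrum ℝ a, 0 < x := by
    rwa [← StarOrderedRing.isStrictlyPositive_iff_spectrum_pos a ha.isSelfAdjoint]
  have e : r • a + (1 - r) • (1 : A) = cfc (fun x : ℝ => r * x + (1 - r)) a := by
    rw [cfc_add_const (1 - r) (fun x : ℝ => r * x) a, cfc_const_mul_id r a,
      Algebra.algebraMap_eq_smul_one]
  rw [e, CFC.rpow_eq_cfc_real ha.nonneg]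
  refine cfc_mono (fun x hx => ?_) (fun x hx =>
    (Real.continuousAt_rpow_const x r (.inl (hpos x hx).ne')).continuousWithinAt)
  have := rpow_one_add_le_one_add_mul_self (s := x - 1) (by linarith [hpos x hx]) hr.1 hr.2
  rw [add_sub_cancel] at this
  linarith

/-- Young's inequality for commuting elements. It is Bernoulli's inequality for `y ^ (1 / r) * x⁻¹`,
conjugated by `x ^ (1 / 2)`. -/
theorem Commute.mul_rpow_le_young {x y : A} (h : Commute y x) (hy : IsStrictlyPositive y)
    (hx : IsStrictlyPositive x) {r : ℝ} (hr0 : 0 < r) (hr1 : r ≤ 1) :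
    y * x ^ (1 - r) ≤ r • y ^ (1 / r) + (1 - r) • x := by
  have hw := h.isStrictlyPositive_rpow_mul_rpow hy hx (1 / r) (-1)
  have key := star_left_conjugate_le_conjugate (rpow_le_smul_add hw ⟨hr0.le, hr1⟩)
    (x ^ (1 / 2 : ℝ))
  rw [(IsSelfAdjoint.of_nonneg (CFC.rpow_nonneg (a := x) (y := 1 / 2))).star_eq,
    h.rpow_mul_rpow_rpow hy hx] at key
  have hconj : ∀ s t : ℝ, x ^ (1 / 2 : ℝ) * (y ^ s * x ^ t) * x ^ (1 / 2 : ℝ)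
      = y ^ s * x ^ (t + 1) := by
    intro s t
    rw [← mul_assoc, (h.symm.rpow_rpow (1 / 2) s).eq, mul_assoc, mul_assoc,
      ← CFC.rpow_add hx.isUnit, ← CFC.rpow_add hx.isUnit]
    congr 2
    ring
  have hx1 : x ^ (1 / 2 : ℝ) * x ^ (1 / 2 : ℝ) = x := by
    rw [← CFC.rpow_add hx.isUnit, add_halves, CFC.rpow_one x hx.nonneg]
  rw [mul_add, add_mul, mul_smul_comm, mul_smul_comm, smul_mul_assoc, smul_mul_assoc, hconj,
    hconj, mul_one, hx1, one_div_mul_cancel hr0.ne', CFC.rpow_one y hy.nonneg, neg_add_cancel,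
    CFC.rpow_zero x hx.nonneg, mul_one, show -1 * r + 1 = 1 - r by ring] at key
  exact key

end CStarAlgebra

/-! ### Left and right multiplication on the Hilbert–Schmidt space -/

namespace HSMatrix

variable {n : Type*} [Fintype n]

lemma inner_eq_trace (X Y : HSMatrix n) :
    inner ℂ X Y = Matrix.trace ((toMat X)ᴴ * toMat Y) := rfl

lemma traceForm_eq_inner (T : HSMatrix n →L[ℂ] HSMatrix n) (K : Matrix n n ℂ) :
    traceForm T K = inner ℂ (toMat.symm K) (T (toMat.symm K)) := rfl

lemma toMat_leftMul (A : Matrix n n ℂ) (X : HSMatrix n) : toMat (leftMul A X) = A * toMat X := rfl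

lemma toMat_rightMul (B : Matrix n n ℂ) (X : HSMatrix n) :
    toMat (rightMul B X) = toMat X * B := rfl

lemma star_leftMul (A : Matrix n n ℂ) : star (leftMul A) = leftMul (star A) := by
  rw [ContinuousLinearMap.star_eq_adjoint, eq_comm, ContinuousLinearMap.eq_adjoint_iff]
  intro X Y
  rw [inner_eq_trace, inner_eq_trace, toMat_leftMul, toMat_leftMul, Matrix.conjTranspose_mul,
    Matrix.star_eq_conjTranspose, Matrix.conjTranspose_conjTranspose, Matrix.mul_assoc]

lemma star_rightMul (B : Matrix n n ℂ) : star (rightMul B) = rightMul (star B) := by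
  rw [ContinuousLinearMap.star_eq_adjoint, eq_comm, ContinuousLinearMap.eq_adjoint_iff]
  intro X Y
  rw [inner_eq_trace, inner_eq_trace, toMat_rightMul, toMat_rightMul, Matrix.conjTranspose_mul,
    Matrix.star_eq_conjTranspose, Matrix.conjTranspose_conjTranspose, Matrix.mul_assoc,
    Matrix.trace_mul_comm, Matrix.mul_assoc]

lemma commute_leftMul_rightMul (A B : Matrix n n ℂ) : Commute (leftMul A) (rightMul B) := by
  ext X : 1
  exact toMat.injective (Matrix.mul_assoc A (toMat X) B).symm

lemma re_traceForm_mono {S T : HSMatrix n →L[ℂ] HSMatrix n} (h : S ≤ T) (K : Matrix n n ℂ) :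
    (traceForm S K).re ≤ (traceForm T K).re := by
  have := ((ContinuousLinearMap.le_def S T).mp h).re_inner_nonneg_right (toMat.symm K)
  rw [sub_apply, inner_sub_right, map_sub, sub_nonneg] at this
  exact this

lemma im_traceForm_eq_zero {T : HSMatrix n →L[ℂ] HSMatrix n} (h : 0 ≤ T) (K : Matrix n n ℂ) :
    (traceForm T K).im = 0 :=
  (Complex.nonneg_iff.mp (((ContinuousLinearMap.nonneg_iff_isPositive T).mp h).inner_nonneg_right
    (toMat.symm K))).2.symm

lemma re_traceForm_smul_add_smul (a b : ℝ) (S T : HSMatrix n →L[ℂ] HSMatrix n)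
    (K : Matrix n n ℂ) :
    (traceForm (a • S + b • T) K).re = a * (traceForm S K).re + b * (traceForm T K).re := by
  simp only [traceForm_eq_inner, add_apply, smul_apply,
    inner_add_right, inner_smul_right_eq_smul, Complex.add_re, Complex.smul_re, smul_eq_mul]

variable [DecidableEq n]

/-- Left multiplication, as a homomorphism of real star algebras. -/
noncomputable def leftMulHom : Matrix n n ℂ →⋆ₐ[ℝ] (HSMatrix n →L[ℂ] HSMatrix n) where
  toFun := leftMul
  map_one' := by ext X : 1; exact toMat.injective (Matrix.one_mul _)
  map_mul' A B := by ext X : 1; exact toMat.injective (Matrix.mul_assoc _ _ _)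
  map_zero' := by ext X : 1; exact toMat.injective (Matrix.zero_mul _)
  map_add' A B := by ext X : 1; exact toMat.injective (Matrix.add_mul _ _ _)
  commutes' c := by
    ext X : 1
    exact toMat.injective (Algebra.smul_def c (toMat X)).symm
  map_star' A := (star_leftMul A).symm

/-- The map `A ↦ R_{A⋆}`, as a homomorphism of real star algebras. Right multiplication alone
reverses products; precomposing with the star repairs this, at the price of complex linearity, and
changes nothing on self-adjoint matrices. -/
noncomputable def rightMulStarHom : Matrix n n ℂ →⋆ₐ[ℝ] (HSMatrix n →L[ℂ] HSMatrix n) where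
  toFun A := rightMul (star A)
  map_one' := by
    ext X : 1
    rw [star_one]
    exact toMat.injective (Matrix.mul_one _)
  map_mul' A B := by
    ext X : 1
    rw [star_mul]
    exact toMat.injective (Matrix.mul_assoc _ _ _).symm
  map_zero' := by
    ext X : 1
    rw [star_zero]
    exact toMat.injective (Matrix.mul_zero _)
  map_add' A B := by
    ext X : 1
    rw [star_add]
    exact toMat.injective (Matrix.mul_add _ _ _)
  commutes' c := by
    ext X : 1
    refine toMat.injective ?_
    rw [← algebraMap_star_comm, star_trivial]
    exact ((Algebra.commutes c (toMat X)).symm.trans (Algebra.smul_def c (toMat X)).symm)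
  map_star' A := (star_rightMul (star A)).symm

/-- Star homomorphisms preserve strict positivity and commute with the functional calculus; their
continuity is automatic as matrices form a finite-dimensional space. -/
lemma _root_.StarAlgHom.isStrictlyPositive_and_map_matrix_rpow
    (φ : Matrix n n ℂ →⋆ₐ[ℝ] (HSMatrix n →L[ℂ] HSMatrix n)) {A : Matrix n n ℂ}
    (hA : IsStrictlyPositive A) (s : ℝ) :
    IsStrictlyPositive (φ A) ∧ φ (A ^ s) = φ A ^ s := by
  have h : IsStrictlyPositive (φ A) := ⟨map_nonneg φ hA.nonneg, hA.isUnit.map φ⟩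
  have hpos : ∀ x ∈ spectrum ℝ A, 0 < x := by
    rwa [← StarOrderedRing.isStrictlyPositive_iff_spectrum_pos A hA.isSelfAdjoint]
  refine ⟨h, ?_⟩
  rw [CFC.rpow_eq_cfc_real hA.nonneg, CFC.rpow_eq_cfc_real h.nonneg]
  exact φ.map_cfc _ A (fun x hx =>
    (Real.continuousAt_rpow_const x s (.inl (hpos x hx).ne')).continuousWithinAt)
    (φ.toAlgHom.toLinearMap.continuous_of_finiteDimensional) hA.isSelfAdjoint h.isSelfAdjoint

lemma isStrictlyPositive_leftMul {A : Matrix n n ℂ} (hA : A.PosDef) :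
    IsStrictlyPositive (leftMul A) :=
  (leftMulHom.isStrictlyPositive_and_map_matrix_rpow hA.isStrictlyPositive 1).1

lemma leftMul_rpow {A : Matrix n n ℂ} (hA : A.PosDef) (s : ℝ) :
    leftMul (A ^ s) = leftMul A ^ s :=
  (leftMulHom.isStrictlyPositive_and_map_matrix_rpow hA.isStrictlyPositive s).2

lemma isStrictlyPositive_rightMul {A : Matrix n n ℂ} (hA : A.PosDef) :
    IsStrictlyPositive (rightMul A) := by
  have := (rightMulStarHom.isStrictlyPositive_and_map_matrix_rpow hA.isStrictlyPositive 1).1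
  rwa [show rightMulStarHom A = rightMul A from congrArg rightMul hA.isHermitian] at this

lemma rightMul_rpow {A : Matrix n n ℂ} (hA : A.PosDef) (s : ℝ) :
    rightMul (A ^ s) = rightMul A ^ s := by
  have := (rightMulStarHom.isStrictlyPositive_and_map_matrix_rpow hA.isStrictlyPositive s).2
  rw [show rightMulStarHom A = rightMul A from congrArg rightMul hA.isHermitian] at this
  rw [← this]
  exact congrArg rightMul (IsSelfAdjoint.of_nonneg CFC.rpow_nonneg).star_eq.symm

lemma leftMul_smul_add_smul (a b : ℝ) (A B : Matrix n n ℂ) :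
    leftMul (a • A + b • B) = a • leftMul A + b • leftMul B :=
  (map_add leftMulHom _ _).trans (congrArg₂ _ (map_smul leftMulHom a A)
    (map_smul leftMulHom b B))

lemma rightMul_smul_add_smul (a b : ℝ) (A B : Matrix n n ℂ) :
    rightMul (a • A + b • B) = a • rightMul A + b • rightMul B := by
  have h : ∀ C : Matrix n n ℂ, rightMul C = rightMulStarHom (star C) := fun C =>
    congrArg rightMul (star_star C).symm
  simp only [h, star_add, star_smul, star_trivial, map_add, map_smul]

lemma traceForm_leftMul_one (A : Matrix n n ℂ) : traceForm (leftMul A) 1 = A.trace := by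
  rw [traceForm, toMat_leftMul, LinearEquiv.apply_symm_apply, Matrix.conjTranspose_one,
    Matrix.one_mul, Matrix.mul_one]

lemma traceForm_rightMul_one (B : Matrix n n ℂ) : traceForm (rightMul B) 1 = B.trace := by
  rw [traceForm, toMat_rightMul, LinearEquiv.apply_symm_apply, Matrix.conjTranspose_one,
    Matrix.one_mul, Matrix.one_mul]

lemma traceForm_leftMul_mul_rightMul_one (A B : Matrix n n ℂ) :
    traceForm (leftMul A * rightMul B) 1 = (A * B).trace := by
  rw [traceForm, mul_apply_eq_comp, toMat_leftMul, toMat_rightMul,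
    LinearEquiv.apply_symm_apply, Matrix.conjTranspose_one, Matrix.one_mul, Matrix.one_mul]

end HSMatrix

/-! ### Concavity of the trace functions -/

section TraceFunctions

open HSMatrix

lemma Matrix.PosDef.smul_add_smul {n : Type*} {A B : Matrix n n ℂ} (hA : A.PosDef) (hB : B.PosDef)
    {a b : ℝ} (ha : 0 < a) (hb : 0 < b) : (a • A + b • B).PosDef :=
  (hA.smul ha).add (hB.smul hb)

variable {n : Type*} [Fintype n]

lemma convex_posDefPairs : Convex ℝ (posDefPairs n) :=
  convex_iff_forall_pos.mpr fun _ hX _ hY _ _ ha hb _ =>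
    ⟨hX.1.smul_add_smul hY.1 ha hb, hX.2.smul_add_smul hY.2 ha hb⟩

lemma trace_im_eq_zero {X : Matrix n n ℂ} (hX : 0 ≤ X) : X.trace.im = 0 :=
  (Complex.nonneg_iff.mp (Matrix.nonneg_iff_posSemidef.mp hX).trace_nonneg).2.symm

variable [DecidableEq n]

lemma Matrix.PosDef.rpow {A : Matrix n n ℂ} (hA : A.PosDef) (s : ℝ) : (A ^ s).PosDef :=
  Matrix.isStrictlyPositive_iff_posDef.mp (hA.isStrictlyPositive.rpow A s)

/-- Lieb's concavity theorem for the trace of `A ^ p * X ^ q`. -/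
lemma trace_rpow_mul_rpow_concave {A₁ A₂ X₁ X₂ : Matrix n n ℂ} (hA₁ : A₁.PosDef) (hA₂ : A₂.PosDef)
    (hX₁ : X₁.PosDef) (hX₂ : X₂.PosDef) {a b : ℝ} (ha : 0 < a) (hb : 0 < b) (hab : a + b = 1)
    {p q : ℝ} (hp : 0 < p) (hq : 0 ≤ q) (hpq : p + q ≤ 1) :
    a * (A₁ ^ p * X₁ ^ q).trace.re + b * (A₂ ^ p * X₂ ^ q).trace.re
      ≤ ((a • A₁ + b • A₂) ^ p * (a • X₁ + b • X₂) ^ q).trace.re := by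
  have hA := hA₁.smul_add_smul hA₂ ha hb
  have hX := hX₁.smul_add_smul hX₂ ha hb
  have h := rpow_mul_rpow_concave (isStrictlyPositive_leftMul hA₁) (isStrictlyPositive_rightMul hX₁)
    (commute_leftMul_rightMul _ _) (isStrictlyPositive_leftMul hA₂)
    (isStrictlyPositive_rightMul hX₂) (commute_leftMul_rightMul _ _) ha hb hab
    (by rw [← leftMul_smul_add_smul, ← rightMul_smul_add_smul]
        exact commute_leftMul_rightMul _ _) hp hq hpq
  rw [← leftMul_smul_add_smul, ← rightMul_smul_add_smul, ← leftMul_rpow hA₁, ← leftMul_rpow hA₂,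
    ← leftMul_rpow hA, ← rightMul_rpow hX₁, ← rightMul_rpow hX₂, ← rightMul_rpow hX] at h
  have := re_traceForm_mono h 1
  simpa only [re_traceForm_smul_add_smul, traceForm_leftMul_mul_rightMul_one] using this

/-- Young's inequality for the trace; `Y` and `X` need not commute. -/
lemma trace_mul_rpow_le_young {Y X : Matrix n n ℂ} (hY : Y.PosDef) (hX : X.PosDef) {r : ℝ}
    (hr0 : 0 < r) (hr1 : r ≤ 1) :
    (Y * X ^ (1 - r)).trace.re ≤ r * (Y ^ (1 / r)).trace.re + (1 - r) * X.trace.re := by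
  have h := (commute_leftMul_rightMul Y X).mul_rpow_le_young (isStrictlyPositive_leftMul hY)
    (isStrictlyPositive_rightMul hX) hr0 hr1
  rw [← leftMul_rpow hY, ← rightMul_rpow hX] at h
  have := re_traceForm_mono h 1
  simpa only [re_traceForm_smul_add_smul, traceForm_leftMul_mul_rightMul_one,
    traceForm_leftMul_one, traceForm_rightMul_one] using this

/-- The maximizer `X = Y ^ (1 / r)` in Young's inequality for the trace. -/
lemma mul_rpow_rpow_one_sub_eq {Y : Matrix n n ℂ} (hY : Y.PosDef) {r : ℝ} (hr : 0 < r) :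
    Y * (Y ^ (1 / r)) ^ (1 - r) = Y ^ (1 / r) := by
  have hY' := hY.isStrictlyPositive
  rw [CFC.rpow_rpow Y _ _ (one_div_pos.mpr hr).ne' hY']
  nth_rw 1 [← CFC.rpow_one Y hY'.nonneg]
  rw [← CFC.rpow_add hY'.isUnit]
  congr 1
  field_simp
  ring

/-- Concavity of the trace function, from its variational formula and Lieb's concavity theorem. -/
theorem concaveOn_trace_rpow_add_rpow {p r : ℝ} (hp : 0 < p) (hpr : p ≤ r) (hr : r ≤ 1) :
    ConcaveOn ℝ (posDefPairs n) fun X => (Matrix.trace ((X.1 ^ p + X.2 ^ p) ^ (1 / r))).re := by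
  refine concaveOn_iff_forall_pos.mpr ⟨convex_posDefPairs, ?_⟩
  rintro ⟨A₁, B₁⟩ ⟨hA₁ : A₁.PosDef, hB₁ : B₁.PosDef⟩ ⟨A₂, B₂⟩ ⟨hA₂ : A₂.PosDef, hB₂ : B₂.PosDef⟩
    a b ha hb hab
  change a * ((A₁ ^ p + B₁ ^ p) ^ (1 / r)).trace.re + b * ((A₂ ^ p + B₂ ^ p) ^ (1 / r)).trace.re
    ≤ (((a • A₁ + b • A₂) ^ p + (a • B₁ + b • B₂) ^ p) ^ (1 / r)).trace.re
  have hr0 : 0 < r := hp.trans_le hpr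
  have hY₁ : (A₁ ^ p + B₁ ^ p).PosDef := (hA₁.rpow p).add (hB₁.rpow p)
  have hY₂ : (A₂ ^ p + B₂ ^ p).PosDef := (hA₂.rpow p).add (hB₂.rpow p)
  have hX₁ := hY₁.rpow (1 / r)
  have hX₂ := hY₂.rpow (1 / r)
  have hY : ((a • A₁ + b • A₂) ^ p + (a • B₁ + b • B₂) ^ p).PosDef :=
    ((hA₁.smul_add_smul hA₂ ha hb).rpow p).add ((hB₁.smul_add_smul hB₂ ha hb).rpow p)
  -- The variational formula is used at the maximizers `Xᵢ = Yᵢ ^ (1 / r)` of the two endpoints,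
  -- and at `a • X₁ + b • X₂` for the convex combination.
  have e₁ := congrArg (fun M => M.trace.re) (mul_rpow_rpow_one_sub_eq hY₁ hr0)
  have e₂ := congrArg (fun M => M.trace.re) (mul_rpow_rpow_one_sub_eq hY₂ hr0)
  have hLA := trace_rpow_mul_rpow_concave hA₁ hA₂ hX₁ hX₂ ha hb hab hp (sub_nonneg.mpr hr)
    (by linarith)
  have hLB := trace_rpow_mul_rpow_concave hB₁ hB₂ hX₁ hX₂ ha hb hab hp (sub_nonneg.mpr hr)
    (by linarith)
  have hYg := trace_mul_rpow_le_young hY (hX₁.smul_add_smul hX₂ ha hb) hr0 hr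
  simp only [Matrix.add_mul, Matrix.trace_add, Complex.add_re, Matrix.trace_smul, Complex.smul_re,
    smul_eq_mul] at e₁ e₂ hYg
  refine le_of_mul_le_mul_left ?_ hr0
  rw [← e₁, ← e₂] at hYg ⊢
  linarith

theorem concaveOn_traceForm_rpow_add_rpow {p r : ℝ} (hp : 0 < p) (hpr : p ≤ r) (hr : r ≤ 1)
    (K : Matrix n n ℂ) :
    ConcaveOn ℝ (posDefPairs n) fun X => (traceForm
      ((leftMul X.1 ^ p + rightMul X.2 ^ p) ^ (1 / r)) K).re := by
  refine concaveOn_iff_forall_pos.mpr ⟨convex_posDefPairs, ?_⟩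
  intro X hX Y hY a b ha hb hab
  have h := rpow_add_rpow_rpow_concave (isStrictlyPositive_leftMul hX.1)
    (isStrictlyPositive_rightMul hX.2) (commute_leftMul_rightMul _ _)
    (isStrictlyPositive_leftMul hY.1) (isStrictlyPositive_rightMul hY.2)
    (commute_leftMul_rightMul _ _) ha hb hab
    (by rw [← leftMul_smul_add_smul, ← rightMul_smul_add_smul]
        exact commute_leftMul_rightMul _ _) hp hpr hr
  rw [← leftMul_smul_add_smul, ← rightMul_smul_add_smul] at h
  have := re_traceForm_mono h K
  rwa [re_traceForm_smul_add_smul] at this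

end TraceFunctions

/-- All real powers are those of the continuous functional calculus: of matrices in the first part,
of operators on the Hilbert space of matrices in the second. In each part the (a priori complex)
value of the trace function is claimed to be real, and the resulting real function concave. -/
theorem mainTheorem4 {n : Type*} [Fintype n] [DecidableEq n] (p r : ℝ)
    (hp : 0 < p) (hpr : p ≤ r) (hr : r ≤ 1) :
    ((∀ X ∈ posDefPairs n, (Matrix.trace ((X.1 ^ p + X.2 ^ p) ^ (1 / r))).im = 0) ∧
      ConcaveOn ℝ (posDefPairs n)
        (fun X => (Matrix.trace ((X.1 ^ p + X.2 ^ p) ^ (1 / r))).re)) ∧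
    (∀ K : Matrix n n ℂ,
      (∀ X ∈ posDefPairs n,
        (HSMatrix.traceForm
          ((HSMatrix.leftMul X.1 ^ p + HSMatrix.rightMul X.2 ^ p) ^ (1 / r)) K).im = 0) ∧
      ConcaveOn ℝ (posDefPairs n)
        (fun X => (HSMatrix.traceForm
          ((HSMatrix.leftMul X.1 ^ p + HSMatrix.rightMul X.2 ^ p) ^ (1 / r)) K).re)) :=
  ⟨⟨fun _ _ => trace_im_eq_zero CFC.rpow_nonneg, concaveOn_trace_rpow_add_rpow hp hpr hr⟩,
    fun K => ⟨fun _ _ => HSMatrix.im_traceForm_eq_zero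
        (CFC.rpow_nonneg (A := HSMatrix n →L[ℂ] HSMatrix n)) K,
      concaveOn_traceForm_rpow_add_rpow hp hpr hr K⟩⟩
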